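/- Let $(X,\rho,\mu)$ be a metric measure space, that is, $\rho$ is a metric on $X$ and $\mu$ is a Borel measure on $X$ such that every open ball has strictly positive and finite measure. For $1\le p<\infty$, let $BMO^p(X)$ be the set of all functions $f\colon X\to\mathbb{C}$ that are integrable on every ball and satisfy $$\|f\|_{*,p}:=\sup_{B}\Big(\frac{1}{\mu(B)}\int_B|f-f_B|^p\,d\mu\Big)^{1/p}<\infty,\qquad f_B:=\frac{1}{\mu(B)}\int_B f\,d\mu,$$ where the supremum is taken over all open balls $B$ in $X$; write $BMO(X)=BMO^1(X)$. **Theorem 1.** For every metric measure space $X$, exactly one of the following three cases holds. (a) All the spaces $BMO^p(X)$, $p\ge 1$, coincide. (b) There exists $p_0>1$ such that $BMO^p(X)=BMO(X)$ for all $1\le p<p_0$, and $BMO^{p_2}(X)\subsetneq BMO^{p_1}(X)$ for all $1\le p_1<p_2<\infty$ with $p_2\ge p_0$. (c) There exists $p_0\ge 1$ such that $BMO^p(X)=BMO(X)$ for all $1\le p\le p_0$, and $BMO^{p_2}(X)\subsetneq BMO^{p_1}(X)$ for all $1\le p_1<p_2<\infty$ with $p_2>p_0$. Conversely, there is a nonempty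 metric measure space for which (a) holds; for every $p_0>1$ there is a nonempty metric measure space for which (b) holds with this $p_0$; and for every $p_0\ge 1$ there is a nonempty metric measure space for which (c) holds with this $p_0$. -/

import Mathlib

open MeasureTheory
open scoped ENNReal

/-- The measure of every open ball (of positive radius) is strictly positive and finite. -/
def BallsPosFinite {X : Type*} [MetricSpace X] [MeasurableSpace X] (μ : Measure X) : Prop :=
  ∀ (c : X) (r : ℝ), 0 < r → 0 < μ (Metric.ball c r) ∧ μ (Metric.ball c r) < ∞

/-- The function `f` is integrable on every open ball. -/
def IntegrableOnBalls {X : Type*} [MetricSpace X] [MeasurableSpace X] (μ : Measure X)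
    (f : X → ℂ) : Prop :=
  ∀ (c : X) (r : ℝ), 0 < r → IntegrableOn f (Metric.ball c r) μ

/-- The quantity `sup_B (1 / μ(B) * ∫_B |f - f_B| ^ p dμ) ^ (1 / p)`, as an extended nonnegative
real number, where `B` runs over all open balls and `f_B` is the average of `f` over `B`. -/
noncomputable def bmoSeminorm {X : Type*} [MetricSpace X] [MeasurableSpace X] (μ : Measure X)
    (p : ℝ) (f : X → ℂ) : ℝ≥0∞ :=
  ⨆ (c : X) (r : ℝ) (_ : 0 < r),
    (⨍⁻ x in Metric.ball c r, ‖f x - ⨍ y in Metric.ball c r, f y ∂μ‖ₑ ^ p ∂μ) ^ (1 / p)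

/-- The space `BMO^p`, as a set of functions. It is closed under adding constants and under
almost everywhere equality, so inclusions and equalities between these sets are the same as
those between the corresponding sets of classes of functions. -/
def BMO {X : Type*} [MetricSpace X] [MeasurableSpace X] (μ : Measure X) (p : ℝ) :
    Set (X → ℂ) :=
  {f | IntegrableOnBalls μ f ∧ bmoSeminorm μ p f < ∞}

/-- All the spaces `BMO^p`, `p ≥ 1`, coincide. -/
def BMOCaseA {X : Type*} [MetricSpace X] [MeasurableSpace X] (μ : Measure X) : Prop :=
  ∀ p₁ p₂ : ℝ, 1 ≤ p₁ → 1 ≤ p₂ → BMO μ p₁ = BMO μ p₂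

/-- `BMO^p` equals `BMO^1` for `1 ≤ p < p₀`, and `BMO^{p₂}` is a proper subset of `BMO^{p₁}`
whenever `1 ≤ p₁ < p₂` and `p₂ ≥ p₀`. -/
def BMOCaseB {X : Type*} [MetricSpace X] [MeasurableSpace X] (μ : Measure X) (p₀ : ℝ) : Prop :=
  (∀ p : ℝ, 1 ≤ p → p < p₀ → BMO μ p = BMO μ 1) ∧
    ∀ p₁ p₂ : ℝ, 1 ≤ p₁ → p₁ < p₂ → p₀ ≤ p₂ → BMO μ p₂ ⊂ BMO μ p₁

/-- `BMO^p` equals `BMO^1` for `1 ≤ p ≤ p₀`, and `BMO^{p₂}` is a proper subset of `BMO^{p₁}`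
whenever `1 ≤ p₁ < p₂` and `p₂ > p₀`. -/
def BMOCaseC {X : Type*} [MetricSpace X] [MeasurableSpace X] (μ : Measure X) (p₀ : ℝ) : Prop :=
  (∀ p : ℝ, 1 ≤ p → p ≤ p₀ → BMO μ p = BMO μ 1) ∧
    ∀ p₁ p₂ : ℝ, 1 ≤ p₁ → p₁ < p₂ → p₀ < p₂ → BMO μ p₂ ⊂ BMO μ p₁

/-- There is a nonempty metric measure space (a metric space with a Borel measure for which every
ball has positive and finite measure) with the property `P`. -/
def ExistsMetricMeasureSpace
    (P : ∀ (X : Type) [MetricSpace X] [MeasurableSpace X], Measure X → Prop) : Prop :=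
  ∃ (X : Type) (_ : MetricSpace X) (_ : MeasurableSpace X) (_ : BorelSpace X) (μ : Measure X),
    Nonempty X ∧ BallsPosFinite μ ∧ P X μ

/-! Trichotomy. Everything follows from one extrapolation fact: if `BMO μ p₁ ⊆ BMO μ p₂` for some
`p₁ < p₂`, then already `BMO μ 1 ⊆ BMO μ p₂`. Hence the exponents whose space equals `BMO μ 1` form
an initial interval, all inclusions ending beyond it are strict, and the three cases are: interval
unbounded, supremum missed, supremum attained.

Composing with an `α`-Hölder map sends `BMO μ (α * p₁)` to `BMO μ p₁`, where the hypothesis improves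
the exponent to `p₂`. To recover information on `f ≥ 0` itself, take the maps `dist(·, A) ^ α`. With
`A = {0}` they control `|f - a|` where it is at least `a / 4`. If the remaining part had unbounded
averages, lacunary centers `aₙ` could be chosen along bad balls, and `A = {aₙ}` would give a
contradiction, since near `aₙ` the distance to `A` is at least `|f - aₙ|`. So inclusion passes from
`(p₁, p₂)` to `(α p₁, α p₂)` (`BMO_mul_subset_of_subset`), and iterating with ratio `p₂ / p₁` climbs
from `1` to `p₁`.

Examples. On `PathSpace` a ball is either a set of neighbours of its center or the whole space. For
slowly varying weights `u`, small balls say that `f` has bounded increments, so `f` grows at most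
linearly, and the large ball asks for a finite `p`-th moment. Thus `BMO^p = BMO^1` exactly when `∑
(k + 2) ^ p * u k` converges, and `u` can be chosen with any prescribed threshold. -/

/-! ### Oscillation over balls with free centers, and Hölder composition. -/

section BallAverages

variable {X : Type*} [MetricSpace X] [MeasurableSpace X]

/-- The normalized restriction of `μ` to an open ball. -/
noncomputable def ballProb (μ : Measure X) (c : X) (r : ℝ) : Measure X :=
  (μ (Metric.ball c r))⁻¹ • μ.restrict (Metric.ball c r)

lemma isProbabilityMeasure_ballProb {μ : Measure X} (hμ : BallsPosFinite μ) (c : X) {r : ℝ}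
    (hr : 0 < r) : IsProbabilityMeasure (ballProb μ c r) := by
  refine ⟨?_⟩
  obtain ⟨h0, h1⟩ := hμ c r hr
  simp [ballProb, ENNReal.inv_mul_cancel h0.ne' h1.ne]

lemma IntegrableOnBalls.integrable_ballProb {μ : Measure X} (hμ : BallsPosFinite μ) {f : X → ℂ}
    (hf : IntegrableOnBalls μ f) (c : X) {r : ℝ} (hr : 0 < r) :
    Integrable f (ballProb μ c r) :=
  Integrable.smul_measure (hf c r hr) (ENNReal.inv_ne_top.2 (hμ c r hr).1.ne')

/-- The averages of `‖f - a‖ ^ p` over balls are bounded, where the constant `a` is allowed to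
depend on the ball. -/
def HasOscBound (μ : Measure X) (p : ℝ) (f : X → ℂ) (a : X → ℝ → ℂ) : Prop :=
  ∃ C : ℝ≥0∞, C ≠ ∞ ∧ ∀ c r, 0 < r → ∫⁻ x, ‖f x - a c r‖ₑ ^ p ∂ballProb μ c r ≤ C

lemma lintegral_rpow_le_of_exponent_le {Ω : Type*} [MeasurableSpace Ω] (ν : Measure Ω)
    [IsProbabilityMeasure ν] {g : Ω → ℂ} (hg : AEStronglyMeasurable g ν) {p q : ℝ} (hp : 0 < p)
    (hpq : p ≤ q) : ∫⁻ x, ‖g x‖ₑ ^ p ∂ν ≤ (∫⁻ x, ‖g x‖ₑ ^ q ∂ν) ^ (p / q) := by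
  have h := eLpNorm'_le_eLpNorm'_of_exponent_le hp hpq ν hg
  simp only [eLpNorm'] at h
  have h2 := ENNReal.rpow_le_rpow h hp.le
  rwa [← ENNReal.rpow_mul, ← ENNReal.rpow_mul, one_div_mul_cancel hp.ne', ENNReal.rpow_one,
    one_div, ← div_eq_inv_mul] at h2

lemma HasOscBound.mono {μ : Measure X} (hμ : BallsPosFinite μ) {f : X → ℂ}
    (hf : IntegrableOnBalls μ f) {a : X → ℝ → ℂ} {p q : ℝ} (hp : 0 < p) (hpq : p ≤ q)
    (h : HasOscBound μ q f a) : HasOscBound μ p f a := by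
  obtain ⟨C, hC, h⟩ := h
  have hq : 0 < q := hp.trans_le hpq
  refine ⟨C ^ (p / q), ENNReal.rpow_ne_top_of_nonneg (by positivity) hC, fun c r hr => ?_⟩
  have := isProbabilityMeasure_ballProb hμ c hr
  have hi := (hf.integrable_ballProb hμ c hr).sub (integrable_const (a c r))
  exact (lintegral_rpow_le_of_exponent_le _ hi.aestronglyMeasurable hp hpq).trans
    (ENNReal.rpow_le_rpow (h c r hr) (by positivity))

/-- Averaging `|f - a| + |f - b|` bounds `|a - b|` uniformly over balls, so a bound at exponent `p`
moves from uncontrolled centers `b` to prescribed centers `a` that are good only at exponent `1`. -/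
lemma HasOscBound.recenter {μ : Measure X} (hμ : BallsPosFinite μ) {f : X → ℂ}
    (hf : IntegrableOnBalls μ f) {a b : X → ℝ → ℂ} {p : ℝ} (hp : 1 ≤ p)
    (ha : HasOscBound μ 1 f a) (hb : HasOscBound μ p f b) : HasOscBound μ p f a := by
  obtain ⟨D, hD, hb1⟩ := hb.mono hμ hf one_pos hp
  obtain ⟨A, hA, ha⟩ := ha
  obtain ⟨B, hB, hb⟩ := hb
  have hp0 : 0 ≤ p := by linarith
  refine ⟨2 ^ (p - 1) * (B + (D + A) ^ p), ?_, fun c r hr => ?_⟩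
  · refine ENNReal.mul_ne_top (ENNReal.rpow_ne_top_of_nonneg (by linarith) (by simp)) ?_
    exact ENNReal.add_ne_top.2 ⟨hB, ENNReal.rpow_ne_top_of_nonneg hp0
      (ENNReal.add_ne_top.2 ⟨hD, hA⟩)⟩
  have := isProbabilityMeasure_ballProb hμ c hr
  set ν := ballProb μ c r
  have hi := (hf.integrable_ballProb hμ c hr)
  have hm : ∀ z : ℂ, AEMeasurable (fun x => ‖f x - z‖ₑ) ν := fun z =>
    (hi.sub (integrable_const z)).aestronglyMeasurable.enorm
  have hab : ‖b c r - a c r‖ₑ ≤ D + A := by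
    calc ‖b c r - a c r‖ₑ = ∫⁻ _, ‖b c r - a c r‖ₑ ∂ν := by simp
      _ ≤ ∫⁻ x, (‖f x - b c r‖ₑ + ‖f x - a c r‖ₑ) ∂ν := by
          refine lintegral_mono fun x => ?_
          rw [← enorm_neg (f x - b c r)]
          refine (le_of_eq ?_).trans (enorm_add_le _ _)
          congr 1; ring
      _ = ∫⁻ x, ‖f x - b c r‖ₑ ∂ν + ∫⁻ x, ‖f x - a c r‖ₑ ∂ν := lintegral_add_left' (hm _) _
      _ ≤ D + A := by
          have h1 := hb1 c r hr
          have h2 := ha c r hr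
          simp only [ENNReal.rpow_one] at h1 h2
          exact add_le_add h1 h2
  calc ∫⁻ x, ‖f x - a c r‖ₑ ^ p ∂ν
      ≤ ∫⁻ x, 2 ^ (p - 1) * (‖f x - b c r‖ₑ ^ p + (D + A) ^ p) ∂ν := by
        refine lintegral_mono fun x => ?_
        refine le_trans ?_ ((ENNReal.rpow_le_rpow (add_le_add_right hab ‖f x - b c r‖ₑ)
          hp0).trans (ENNReal.rpow_add_le_mul_rpow_add_rpow _ _ hp))
        refine ENNReal.rpow_le_rpow ((le_of_eq ?_).trans (enorm_add_le _ _)) hp0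
        congr 1; ring
    _ = 2 ^ (p - 1) * (∫⁻ x, ‖f x - b c r‖ₑ ^ p ∂ν + (D + A) ^ p) := by
        rw [lintegral_const_mul' _ _ (ENNReal.rpow_ne_top_of_nonneg (by linarith) (by simp)),
          lintegral_add_right _ measurable_const]
        simp
    _ ≤ _ := by gcongr; exact hb c r hr

/-- The centers in the definition of `BMO` may be arbitrary. -/
lemma mem_BMO_iff {μ : Measure X} (hμ : BallsPosFinite μ) {p : ℝ} (hp : 1 ≤ p) {f : X → ℂ} :
    f ∈ BMO μ p ↔ IntegrableOnBalls μ f ∧ ∃ a, HasOscBound μ p f a := by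
  have hp0 : 0 < p := by linarith
  have key : ∀ c r, ⨍⁻ x in Metric.ball c r, ‖f x - ⨍ y in Metric.ball c r, f y ∂μ‖ₑ ^ p ∂μ
      = ∫⁻ x, ‖f x - ∫ y, f y ∂ballProb μ c r‖ₑ ^ p ∂ballProb μ c r := fun c r => by
    rw [setLAverage_eq', setAverage_eq']; rfl
  refine and_congr_right fun hf => ⟨fun h => ?_, fun ⟨a, h⟩ => ?_⟩
  · refine ⟨fun c r => ∫ y, f y ∂ballProb μ c r, bmoSeminorm μ p f ^ p,
      ENNReal.rpow_ne_top_of_nonneg hp0.le h.ne, fun c r hr => ?_⟩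
    rw [← key c r]
    have : (⨍⁻ x in Metric.ball c r, ‖f x - ⨍ y in Metric.ball c r, f y ∂μ‖ₑ ^ p ∂μ) ^ (1 / p)
        ≤ bmoSeminorm μ p f := le_iSup_of_le c (le_iSup_of_le r (le_iSup_of_le hr le_rfl))
    have h2 := ENNReal.rpow_le_rpow this hp0.le
    rwa [← ENNReal.rpow_mul, one_div_mul_cancel hp0.ne', ENNReal.rpow_one] at h2
  · obtain ⟨D, hD, hD1⟩ := h.mono hμ hf one_pos hp
    -- By the triangle inequality for integrals the mean lies within `D` of `a`, so means are
    -- admissible centers at exponent `1`; recentering then lifts this to `p`.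
    have h1 : HasOscBound μ 1 f (fun c r => ∫ y, f y ∂ballProb μ c r) := by
      refine ⟨D + D, ENNReal.add_ne_top.2 ⟨hD, hD⟩, fun c r hr => ?_⟩
      have := isProbabilityMeasure_ballProb hμ c hr
      set ν := ballProb μ c r
      have hi := (hf.integrable_ballProb hμ c hr)
      have hDr : ∫⁻ x, ‖f x - a c r‖ₑ ∂ν ≤ D := by simpa using hD1 c r hr
      have hmean : ‖a c r - ∫ y, f y ∂ν‖ₑ ≤ D := by
        rw [← enorm_neg, neg_sub]
        have : ∫ y, f y ∂ν - a c r = ∫ y, (f y - a c r) ∂ν := by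
          rw [integral_sub hi (integrable_const _)]; simp [ν]
        rw [this]
        exact (enorm_integral_le_lintegral_enorm _).trans hDr
      simp only [ENNReal.rpow_one]
      calc ∫⁻ x, ‖f x - ∫ y, f y ∂ν‖ₑ ∂ν ≤ ∫⁻ x, (‖f x - a c r‖ₑ + D) ∂ν := by
            refine lintegral_mono fun x => ?_
            refine le_trans ((le_of_eq ?_).trans (enorm_add_le (f x - a c r) _))
              (add_le_add_right hmean _)
            congr 1; ring
        _ = ∫⁻ x, ‖f x - a c r‖ₑ ∂ν + D := by
            rw [lintegral_add_right _ measurable_const]; simp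
        _ ≤ D + D := by gcongr
    obtain ⟨C, hC, hb⟩ := h1.recenter hμ hf hp h
    refine lt_of_le_of_lt ?_ (ENNReal.rpow_lt_top_of_nonneg (y := 1 / p) (by positivity) hC)
    refine iSup_le fun c => iSup_le fun r => iSup_le fun hr => ?_
    refine ENNReal.rpow_le_rpow ?_ (by positivity)
    rw [key c r]
    exact hb c r hr

lemma BMO_antitone {μ : Measure X} (hμ : BallsPosFinite μ) {p q : ℝ} (hp : 1 ≤ p) (hpq : p ≤ q) :
    BMO μ q ⊆ BMO μ p := by
  intro f hf
  rw [mem_BMO_iff hμ (hp.trans hpq)] at hf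
  rw [mem_BMO_iff hμ hp]
  obtain ⟨hi, a, ha⟩ := hf
  exact ⟨hi, a, ha.mono hμ hi (by linarith) hpq⟩

lemma add_mem_BMO {μ : Measure X} (hμ : BallsPosFinite μ) {p : ℝ} (hp : 1 ≤ p) {f g : X → ℂ}
    (hf : f ∈ BMO μ p) (hg : g ∈ BMO μ p) : (fun x => f x + g x) ∈ BMO μ p := by
  rw [mem_BMO_iff hμ hp] at *
  obtain ⟨hfi, a, A, hA, ha⟩ := hf
  obtain ⟨hgi, b, B, hB, hb⟩ := hg
  have htop : (2 : ℝ≥0∞) ^ (p - 1) ≠ ∞ := ENNReal.rpow_ne_top_of_nonneg (by linarith) (by simp)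
  refine ⟨fun c r hr => (hfi c r hr).add (hgi c r hr), fun c r => a c r + b c r,
    2 ^ (p - 1) * (A + B), ENNReal.mul_ne_top htop (ENNReal.add_ne_top.2 ⟨hA, hB⟩),
    fun c r hr => ?_⟩
  have := isProbabilityMeasure_ballProb hμ c hr
  have hm : AEMeasurable (fun x => ‖f x - a c r‖ₑ ^ p) (ballProb μ c r) :=
    ((hfi.integrable_ballProb hμ c hr).sub
      (integrable_const (a c r))).aestronglyMeasurable.enorm.pow_const p
  calc ∫⁻ x, ‖f x + g x - (a c r + b c r)‖ₑ ^ p ∂ballProb μ c r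
      ≤ ∫⁻ x, 2 ^ (p - 1) * (‖f x - a c r‖ₑ ^ p + ‖g x - b c r‖ₑ ^ p) ∂ballProb μ c r := by
        refine lintegral_mono fun x => le_trans (ENNReal.rpow_le_rpow ?_ (by linarith))
          (ENNReal.rpow_add_le_mul_rpow_add_rpow _ _ hp)
        refine (le_of_eq ?_).trans (enorm_add_le _ _)
        congr 1; ring
    _ = 2 ^ (p - 1) * (∫⁻ x, ‖f x - a c r‖ₑ ^ p ∂ballProb μ c r
          + ∫⁻ x, ‖g x - b c r‖ₑ ^ p ∂ballProb μ c r) := by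
        rw [lintegral_const_mul' _ _ htop, lintegral_add_left' hm]
    _ ≤ _ := by gcongr; exacts [ha c r hr, hb c r hr]

lemma IntegrableOnBalls.holder_comp [BorelSpace X] {μ : Measure X} (hμ : BallsPosFinite μ)
    {f : X → ℂ} (hf : IntegrableOnBalls μ f) {φ : ℂ → ℂ} {K α : NNReal} (hα : 0 < α) (hα1 : α ≤ 1)
    (hφ : HolderWith K α φ) : IntegrableOnBalls μ (fun x => φ (f x)) := by
  intro c r hr
  have hfin : IsFiniteMeasure (μ.restrict (Metric.ball c r)) :=
    ⟨by simpa using (hμ c r hr).2⟩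
  have hf' : Integrable f (μ.restrict (Metric.ball c r)) := hf c r hr
  have hdom : Integrable (fun x => ‖φ 0‖ + K * (1 + ‖f x‖)) (μ.restrict (Metric.ball c r)) :=
    (integrable_const _).add (((integrable_const _).add hf'.norm).const_mul _)
  refine hdom.mono' ((hφ.continuous hα).comp_aestronglyMeasurable hf'.aestronglyMeasurable)
    (Filter.Eventually.of_forall fun x => ?_)
  have h1 : ‖φ (f x) - φ 0‖ ≤ K * ‖f x‖ ^ (α : ℝ) := by
    simpa [dist_eq_norm] using hφ.dist_le (f x) 0
  have h2 : ‖f x‖ ^ (α : ℝ) ≤ 1 + ‖f x‖ := by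
    have hα' : (α : ℝ) ≤ 1 := by exact_mod_cast hα1
    calc ‖f x‖ ^ (α : ℝ) ≤ (1 + ‖f x‖) ^ (α : ℝ) :=
          Real.rpow_le_rpow (norm_nonneg _) (by linarith) α.2
      _ ≤ (1 + ‖f x‖) ^ (1 : ℝ) := Real.rpow_le_rpow_of_exponent_le
          (by linarith [norm_nonneg (f x)]) hα'
      _ = _ := Real.rpow_one _
  calc ‖φ (f x)‖ = ‖φ 0 + (φ (f x) - φ 0)‖ := by congr 1; ring
    _ ≤ ‖φ 0‖ + ‖φ (f x) - φ 0‖ := norm_add_le _ _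
    _ ≤ _ := by gcongr; exact h1.trans (mul_le_mul_of_nonneg_left h2 K.2)

/-- The Hölder exponent is traded for integrability, and the centers are simply transported by `φ`.
-/
lemma HasOscBound.holder_comp {μ : Measure X} {f : X → ℂ} {a : X → ℝ → ℂ} {φ : ℂ → ℂ}
    {K α : NNReal} {p : ℝ} (hp : 0 ≤ p) (hφ : HolderWith K α φ)
    (h : HasOscBound μ (α * p) f a) :
    HasOscBound μ p (fun x => φ (f x)) (fun c r => φ (a c r)) := by
  obtain ⟨A, hA, ha⟩ := h
  refine ⟨(K : ℝ≥0∞) ^ p * A, ENNReal.mul_ne_top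
    (ENNReal.rpow_ne_top_of_nonneg hp ENNReal.coe_ne_top) hA, fun c r hr => ?_⟩
  calc ∫⁻ x, ‖φ (f x) - φ (a c r)‖ₑ ^ p ∂ballProb μ c r
      ≤ ∫⁻ x, (K : ℝ≥0∞) ^ p * ‖f x - a c r‖ₑ ^ (α * p) ∂ballProb μ c r := by
        refine lintegral_mono fun x => ?_
        rw [ENNReal.rpow_mul, ← ENNReal.mul_rpow_of_nonneg _ _ hp]
        refine ENNReal.rpow_le_rpow ?_ hp
        simpa [edist_eq_enorm_sub] using hφ (f x) (a c r)
    _ = (K : ℝ≥0∞) ^ p * ∫⁻ x, ‖f x - a c r‖ₑ ^ (α * p) ∂ballProb μ c r :=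
        lintegral_const_mul' _ _ (ENNReal.rpow_ne_top_of_nonneg hp ENNReal.coe_ne_top)
    _ ≤ _ := by gcongr; exact ha c r hr

lemma lipschitz_comp_mem_BMO [BorelSpace X] {μ : Measure X} (hμ : BallsPosFinite μ) {p : ℝ}
    (hp : 1 ≤ p) {f : X → ℂ} (hf : f ∈ BMO μ p) {φ : ℂ → ℂ} {K : NNReal} (hφ : LipschitzWith K φ) :
    (fun x => φ (f x)) ∈ BMO μ p := by
  rw [mem_BMO_iff hμ hp] at *
  obtain ⟨hfi, a, ha⟩ := hf
  have hφ' : HolderWith K 1 φ := holderWith_one.2 hφ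
  exact ⟨hfi.holder_comp hμ one_pos le_rfl hφ', _,
    HasOscBound.holder_comp (by linarith) hφ' (by simpa using ha)⟩

end BallAverages

/-! ### Elementary inequalities for powers and for distances to lacunary sets. -/

lemma abs_rpow_sub_rpow_le {u v α : ℝ} (hu : 0 ≤ u) (hv : 0 ≤ v) (hα : 0 ≤ α) (hα1 : α ≤ 1) :
    |u ^ α - v ^ α| ≤ |u - v| ^ α := by
  wlog h : v ≤ u generalizing u v
  · rw [abs_sub_comm, abs_sub_comm u]
    exact this hv hu (le_of_not_ge h)
  have h1 := Real.rpow_add_le_add_rpow hv (sub_nonneg.2 h) hα hα1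
  rw [add_sub_cancel] at h1
  rw [abs_of_nonneg (sub_nonneg.2 (Real.rpow_le_rpow hv h hα)), abs_of_nonneg (sub_nonneg.2 h)]
  linarith

/-- When `|x - a| ≥ a / 4`, the smaller of `x`, `a` is at most `4 / 5` of the larger, so taking
`α`-th powers loses only a constant factor. -/
lemma abs_sub_rpow_le_of_far {x a α : ℝ} (hx : 0 ≤ x) (ha : 0 ≤ a) (hα : 0 < α)
    (h : a / 4 ≤ |x - a|) : |x - a| ^ α ≤ (1 - (4 / 5 : ℝ) ^ α)⁻¹ * |x ^ α - a ^ α| := by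
  have hK : 0 < 1 - (4 / 5 : ℝ) ^ α := by
    linarith [Real.rpow_lt_one (by norm_num : (0 : ℝ) ≤ 4 / 5) (by norm_num) hα]
  have main : ∀ u v : ℝ, 0 ≤ u → u ≤ 4 / 5 * v →
      |v - u| ^ α ≤ (1 - (4 / 5 : ℝ) ^ α)⁻¹ * |v ^ α - u ^ α| := by
    intro u v hu huv
    have hv : 0 ≤ v := by linarith
    have h1 : u ^ α ≤ (4 / 5) ^ α * v ^ α := by
      rw [← Real.mul_rpow (by norm_num) hv]; exact Real.rpow_le_rpow hu huv hα.le
    have h2 : |v - u| ^ α ≤ v ^ α :=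
      Real.rpow_le_rpow (abs_nonneg _) (by rw [abs_le]; constructor <;> linarith) hα.le
    rw [le_inv_mul_iff₀ hK]
    refine le_trans ?_ (le_abs_self _)
    nlinarith
  rcases le_abs.1 h with h | h
  · exact main a x ha (by linarith)
  · rw [abs_sub_comm, abs_sub_comm (x ^ α)]
    exact main x a hx (by linarith)

lemma enorm_rpow_le_of_abs_rpow_le {u v w z K α p : ℝ} (hα : 0 ≤ α) (hp : 0 ≤ p) (hK : 0 ≤ K)
    (h : |u - v| ^ α ≤ K * |w - z|) :
    ‖(u : ℂ) - v‖ₑ ^ (α * p) ≤ ENNReal.ofReal K ^ p * ‖(w : ℂ) - z‖ₑ ^ p := by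
  have e : ∀ s t : ℝ, ‖(s : ℂ) - t‖ₑ = ENNReal.ofReal |s - t| := fun s t => by
    rw [← Complex.ofReal_sub, ← ofReal_norm, Complex.norm_real, Real.norm_eq_abs]
  rw [e, e, ENNReal.rpow_mul, ← ENNReal.mul_rpow_of_nonneg _ _ hp,
    ENNReal.ofReal_rpow_of_nonneg (abs_nonneg _) hα, ← ENNReal.ofReal_mul hK]
  exact ENNReal.rpow_le_rpow (ENNReal.ofReal_le_ofReal h) hp

lemma holderWith_infDist_rpow (A : Set ℝ) {α : NNReal} (hα1 : α ≤ 1) :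
    HolderWith 1 α (fun z : ℂ => ((Metric.infDist z.re A ^ (α : ℝ) : ℝ) : ℂ)) := by
  intro z w
  have h1 : |Metric.infDist z.re A - Metric.infDist w.re A| ≤ ‖z - w‖ := by
    have := (Metric.lipschitz_infDist_pt A).dist_le_mul z.re w.re
    rw [Real.dist_eq, Real.dist_eq, NNReal.coe_one, one_mul] at this
    exact this.trans (by simpa using Complex.abs_re_le_norm (z - w))
  have h2 : |Metric.infDist z.re A ^ (α : ℝ) - Metric.infDist w.re A ^ (α : ℝ)|
      ≤ ‖z - w‖ ^ (α : ℝ) :=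
    (abs_rpow_sub_rpow_le Metric.infDist_nonneg Metric.infDist_nonneg α.2
      (by exact_mod_cast hα1)).trans (Real.rpow_le_rpow (abs_nonneg _) h1 α.2)
  dsimp only
  rw [edist_eq_enorm_sub, edist_eq_enorm_sub, ← ofReal_norm, ← ofReal_norm,
    ENNReal.ofReal_rpow_of_nonneg (norm_nonneg _) α.coe_nonneg, ENNReal.coe_one, one_mul,
    ← Complex.ofReal_sub, Complex.norm_real, Real.norm_eq_abs]
  exact ENNReal.ofReal_le_ofReal h2

/-- Lacunarity makes `a n` the closest point of the sequence: smaller terms stay at distance at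
least `a n / 2` from `x`, and larger ones are farther still. -/
lemma abs_sub_le_infDist_range {a : ℕ → ℝ} (ha0 : ∀ n, 0 < a n) (ha : ∀ n, 4 * a n ≤ a (n + 1))
    (n : ℕ) {x : ℝ} (hx : |x - a n| < a n / 4) :
    |x - a n| ≤ Metric.infDist x (Set.range a) := by
  rw [Metric.le_infDist (Set.range_nonempty a)]
  rintro _ ⟨k, rfl⟩
  rw [Real.dist_eq]
  have hmono : Monotone a := monotone_nat_of_le_succ fun n => by linarith [ha n, ha0 n]
  have hlac : ∀ i j, i < j → 4 * a i ≤ a j := fun i j hij => (ha i).trans (hmono hij)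
  have := abs_lt.1 hx
  have := ha0 k
  have := ha0 n
  rcases lt_trichotomy k n with hk | rfl | hk
  · have := hlac k n hk
    exact (abs_le.2 ⟨by linarith, by linarith⟩ : |x - a n| ≤ x - a k).trans (le_abs_self _)
  · exact le_rfl
  · have := hlac n k hk
    exact (abs_le.2 ⟨by linarith, by linarith⟩ : |x - a n| ≤ -(x - a k)).trans (neg_le_abs _)

/-! ### Extrapolation of inclusions to smaller exponents, and the trichotomy. -/

section Extrapolation

variable {X : Type*} [MetricSpace X] [MeasurableSpace X] [BorelSpace X]

lemma ofReal_mem_BMO_of_subset {μ : Measure X} (hμ : BallsPosFinite μ) {p₁ p₂ : ℝ} (hp₁ : 1 ≤ p₁)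
    (hp : p₁ ≤ p₂) (h : BMO μ p₁ ⊆ BMO μ p₂) {α : NNReal} (hα : 0 < α) (hα1 : α ≤ 1)
    (hq : 1 ≤ α * p₁) {f : X → ℝ} (hf0 : ∀ x, 0 ≤ f x)
    (hf : (fun x => (f x : ℂ)) ∈ BMO μ (α * p₁)) : (fun x => (f x : ℂ)) ∈ BMO μ (α * p₂) := by
  have hp₂ : 1 ≤ p₂ := hp₁.trans hp
  have hα' : (0 : ℝ) < α := hα
  have hs : 1 ≤ α * p₂ := hq.trans (by gcongr)
  obtain ⟨hi, b, hb⟩ := (mem_BMO_iff hμ hq).1 hf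
  -- Since `f` is real and nonnegative, the 1-Lipschitz map `z ↦ |Re z|` fixes it while making the
  -- centers nonnegative.
  set a : X → ℝ → ℝ := fun c r => |(b c r).re|
  have ha0 : ∀ c r, 0 ≤ a c r := fun c r => abs_nonneg _
  have ha : HasOscBound μ (α * p₁) (fun x => (f x : ℂ)) (fun c r => (a c r : ℂ)) := by
    have hφ : HolderWith 1 1 (fun z : ℂ => ((|z.re| : ℝ) : ℂ)) := by
      refine holderWith_one.2 (LipschitzWith.of_dist_le_mul fun z w => ?_)
      rw [dist_eq_norm, dist_eq_norm, ← Complex.ofReal_sub, Complex.norm_real, Real.norm_eq_abs,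
        NNReal.coe_one, one_mul]
      exact (abs_abs_sub_abs_le_abs_sub _ _).trans (by simpa using Complex.abs_re_le_norm (z - w))
    have := HasOscBound.holder_comp (p := α * p₁) (by linarith) hφ (by simpa using hb)
    simpa [abs_of_nonneg (hf0 _)] using this
  -- The only use of the assumed inclusion. The freedom in `A` is essential: it is taken to be
  -- `{0}`, and later a set built from bad balls.
  have hA : ∀ A : Set ℝ, HasOscBound μ p₂
      (fun x => ((Metric.infDist (f x) A ^ (α : ℝ) : ℝ) : ℂ))
      (fun c r => ((Metric.infDist (a c r) A ^ (α : ℝ) : ℝ) : ℂ)) := by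
    intro A
    have hφ := holderWith_infDist_rpow A hα1
    have h1 := HasOscBound.holder_comp (by linarith) hφ ha
    have hi' := hi.holder_comp hμ hα hα1 hφ
    obtain ⟨_, b', hb'⟩ := (mem_BMO_iff hμ hp₂).1 (h ((mem_BMO_iff hμ hp₁).2 ⟨hi', _, h1⟩))
    exact HasOscBound.recenter hμ hi' hp₂ (h1.mono hμ hi' one_pos hp₁) hb'
  by_contra hnot
  have hunb : ∀ M : ℝ≥0∞, M ≠ ∞ → ∃ c r, 0 < r ∧
      M < ∫⁻ x, ‖(f x : ℂ) - a c r‖ₑ ^ (α * p₂) ∂ballProb μ c r := by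
    intro M hM
    by_contra! hcon
    exact hnot ((mem_BMO_iff hμ hs).2 ⟨hi, _, M, hM, hcon⟩)
  set near : X → ℝ → ℝ≥0∞ := fun c r => ∫⁻ x, (if |f x - a c r| < a c r / 4 then
    ‖(f x : ℂ) - a c r‖ₑ ^ (α * p₂) else 0) ∂ballProb μ c r
  have hnear : ∀ T : ℝ, ∃ c r, 0 < r ∧ T < a c r ∧ ENNReal.ofReal T < near c r := by
    intro T
    obtain ⟨C, hC, hC0⟩ := hA {0}
    set K : ℝ := (1 - (4 / 5 : ℝ) ^ (α : ℝ))⁻¹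
    have hK : 0 ≤ K := inv_nonneg.2 (by
      linarith [Real.rpow_le_one (by norm_num : (0 : ℝ) ≤ 4 / 5) (by norm_num) hα'.le])
    have hKtop : ENNReal.ofReal K ^ p₂ ≠ ∞ :=
      ENNReal.rpow_ne_top_of_nonneg (by linarith) ENNReal.ofReal_ne_top
    have hTtop : ENNReal.ofReal T ^ (α * p₂) ≠ ∞ :=
      ENNReal.rpow_ne_top_of_nonneg (by linarith) ENNReal.ofReal_ne_top
    -- The first summand pays for the far points, `T` makes the near part exceed `T`, and `T ^ (α *
    -- p₂)` forces `a c r > T`, because the near integrand is at most `(a c r / 4) ^ (α * p₂)`.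
    obtain ⟨c, r, hr, hlt⟩ := hunb (ENNReal.ofReal K ^ p₂ * C
      + (ENNReal.ofReal T + ENNReal.ofReal T ^ (α * p₂)))
      (ENNReal.add_ne_top.2 ⟨ENNReal.mul_ne_top hKtop hC,
        ENNReal.add_ne_top.2 ⟨ENNReal.ofReal_ne_top, hTtop⟩⟩)
    have := isProbabilityMeasure_ballProb hμ c hr
    have hle : ∫⁻ x, ‖(f x : ℂ) - a c r‖ₑ ^ (α * p₂) ∂ballProb μ c r
        ≤ ENNReal.ofReal K ^ p₂ * C + near c r := by
      have hφ := holderWith_infDist_rpow {0} hα1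
      have hm : AEMeasurable (fun x => ENNReal.ofReal K ^ p₂ *
          ‖((Metric.infDist (f x) {0} ^ (α : ℝ) : ℝ) : ℂ)
            - ((Metric.infDist (a c r) {0} ^ (α : ℝ) : ℝ) : ℂ)‖ₑ ^ p₂) (ballProb μ c r) :=
        ((((hi.holder_comp hμ hα hα1 hφ).integrable_ballProb hμ c hr).sub
          (integrable_const _)).aestronglyMeasurable.enorm.pow_const p₂).const_mul _
      calc ∫⁻ x, ‖(f x : ℂ) - a c r‖ₑ ^ (α * p₂) ∂ballProb μ c r
          ≤ ∫⁻ x, (ENNReal.ofReal K ^ p₂ *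
          ‖((Metric.infDist (f x) {0} ^ (α : ℝ) : ℝ) : ℂ)
            - ((Metric.infDist (a c r) {0} ^ (α : ℝ) : ℝ) : ℂ)‖ₑ ^ p₂ +
            (if |f x - a c r| < a c r / 4 then
              ‖(f x : ℂ) - a c r‖ₑ ^ (α * p₂) else 0)) ∂ballProb μ c r := by
            refine lintegral_mono fun x => ?_
            dsimp only
            split_ifs with hx
            · exact le_add_self
            · rw [add_zero]
              refine enorm_rpow_le_of_abs_rpow_le hα'.le (by linarith) hK ?_
              rw [Metric.infDist_singleton, Metric.infDist_singleton, Real.dist_0_eq_abs,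
                Real.dist_0_eq_abs, abs_of_nonneg (hf0 x), abs_of_nonneg (ha0 c r)]
              exact abs_sub_rpow_le_of_far (hf0 x) (ha0 c r) hα' (not_lt.1 hx)
        _ ≤ _ := by
            rw [lintegral_add_left' hm, lintegral_const_mul' _ _ hKtop]
            gcongr
            exact hC0 c r hr
    have hbig := (ENNReal.add_lt_add_iff_left (ENNReal.mul_ne_top hKtop hC)).1 (hlt.trans_le hle)
    refine ⟨c, r, hr, ?_, lt_of_le_of_lt le_self_add hbig⟩
    by_contra! haT
    refine (lt_of_le_of_lt le_add_self hbig).not_ge ?_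
    calc near c r ≤ ∫⁻ _, ENNReal.ofReal T ^ (α * p₂) ∂ballProb μ c r := by
          refine lintegral_mono fun x => ?_
          dsimp only
          split_ifs with hx
          · refine ENNReal.rpow_le_rpow ?_ (by linarith)
            rw [← Complex.ofReal_sub, ← ofReal_norm, Complex.norm_real,
              Real.norm_eq_abs]
            exact ENNReal.ofReal_le_ofReal (by linarith [ha0 c r])
          · exact zero_le
      _ = ENNReal.ofReal T ^ (α * p₂) := by simp
  choose cc rr hrr haT hnT using hnear
  -- Successive thresholds: `n + 1` drives the near parts to infinity, and `4 * a` makes the chosen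
  -- centers lacunary. Any nonnegative starting value would do.
  let s : ℕ → ℝ := fun n => Nat.rec 1 (fun n T => max (n + 1) (4 * a (cc T) (rr T))) n
  have hs_succ : ∀ n, s (n + 1) = max ((n : ℝ) + 1) (4 * a (cc (s n)) (rr (s n))) := fun n => rfl
  have hsn : ∀ n : ℕ, (n : ℝ) ≤ s n := by
    intro n
    cases n with
    | zero => simp [s]
    | succ n => rw [hs_succ]; push_cast; exact le_max_left _ _
  obtain ⟨C, hC, hCb⟩ := hA (Set.range fun n => a (cc (s n)) (rr (s n)))
  obtain ⟨n, hn⟩ := ENNReal.exists_nat_gt hC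
  have hlac := fun x => abs_sub_le_infDist_range (a := fun n => a (cc (s n)) (rr (s n)))
    (fun n => lt_of_le_of_lt ((Nat.cast_nonneg n).trans (hsn n)) (haT (s n)))
    (fun n => by
      have h1 := haT (s (n + 1))
      have h2 : 4 * a (cc (s n)) (rr (s n)) ≤ s (n + 1) := by
        rw [hs_succ]; exact le_max_right _ _
      linarith) n (x := x)
  have hle : near (cc (s n)) (rr (s n)) ≤ C := by
    refine le_trans (lintegral_mono fun x => ?_) (hCb (cc (s n)) (rr (s n)) (hrr _))
    dsimp only
    split_ifs with hx
    -- The transported center is `0`, as the center belongs to `A`; hence on near points the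
    -- oscillation of `dist(f, A) ^ α` dominates `|f - aₙ| ^ α`.
    · have h0 : Metric.infDist (a (cc (s n)) (rr (s n)))
          (Set.range fun n => a (cc (s n)) (rr (s n))) = 0 :=
        Metric.infDist_zero_of_mem ⟨n, rfl⟩
      have := enorm_rpow_le_of_abs_rpow_le (p := p₂) hα'.le (by linarith) zero_le_one
        (u := f x) (v := a (cc (s n)) (rr (s n)))
        (w := Metric.infDist (f x) (Set.range fun n => a (cc (s n)) (rr (s n))) ^ (α : ℝ))
        (z := Metric.infDist (a (cc (s n)) (rr (s n)))
          (Set.range fun n => a (cc (s n)) (rr (s n))) ^ (α : ℝ)) (by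
          rw [h0, Real.zero_rpow hα'.ne', sub_zero, one_mul,
            abs_of_nonneg (Real.rpow_nonneg Metric.infDist_nonneg _)]
          exact Real.rpow_le_rpow (abs_nonneg _) (hlac _ hx) hα'.le)
      simpa using this
    · exact zero_le
  have h3 : (n : ℝ≥0∞) ≤ ENNReal.ofReal (s n) := by
    rw [← ENNReal.ofReal_natCast]; exact ENNReal.ofReal_le_ofReal (hsn n)
  exact absurd (hle.trans_lt (hn.trans_le h3)) (hnT (s n)).not_gt

lemma const_mul_mem_BMO {μ : Measure X} (hμ : BallsPosFinite μ) {p : ℝ} (hp : 1 ≤ p) (z : ℂ)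
    {f : X → ℂ} (hf : f ∈ BMO μ p) : (fun x => z * f x) ∈ BMO μ p :=
  lipschitz_comp_mem_BMO hμ hp hf (φ := fun w => z * w) (K := ‖z‖₊)
    (LipschitzWith.of_dist_le_mul fun v w => by
      rw [dist_eq_norm, dist_eq_norm, ← mul_sub, norm_mul, coe_nnnorm])

lemma BMO_mul_subset_of_subset {μ : Measure X} (hμ : BallsPosFinite μ) {p₁ p₂ : ℝ} (hp₁ : 1 ≤ p₁)
    (hp : p₁ ≤ p₂) (h : BMO μ p₁ ⊆ BMO μ p₂) {α : NNReal} (hα : 0 < α) (hα1 : α ≤ 1)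
    (hq : 1 ≤ α * p₁) : BMO μ (α * p₁) ⊆ BMO μ (α * p₂) := by
  intro f hf
  have hs : 1 ≤ α * p₂ := hq.trans (by gcongr)
  -- Taking `z = ±1, ±i` yields the positive and negative parts of `Re f` and `Im f`, which reduces
  -- to nonnegative functions.
  have hpart : ∀ z : ℂ, (fun x => ((max (z * f x).re 0 : ℝ) : ℂ)) ∈ BMO μ (α * p₂) := by
    intro z
    refine ofReal_mem_BMO_of_subset hμ hp₁ hp h hα hα1 hq (fun x => le_max_right _ _) ?_
    refine lipschitz_comp_mem_BMO hμ hq (const_mul_mem_BMO hμ hq z hf) (K := 1)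
      (φ := fun w => ((max w.re 0 : ℝ) : ℂ)) (LipschitzWith.of_dist_le_mul fun v w => ?_)
    rw [dist_eq_norm, dist_eq_norm, ← Complex.ofReal_sub, Complex.norm_real, Real.norm_eq_abs,
      NNReal.coe_one, one_mul]
    exact (abs_max_sub_max_le_abs _ _ _).trans (by simpa using Complex.abs_re_le_norm (v - w))
  have hsum := add_mem_BMO hμ hs
    (add_mem_BMO hμ hs (hpart 1) (const_mul_mem_BMO hμ hs (-1) (hpart (-1))))
    (add_mem_BMO hμ hs (const_mul_mem_BMO hμ hs Complex.I (hpart (-Complex.I)))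
      (const_mul_mem_BMO hμ hs (-Complex.I) (hpart Complex.I)))
  convert hsum using 1
  have hmax : ∀ t : ℝ, t = max t 0 - max (-t) 0 := fun t => by
    rcases le_total t 0 with ht | ht <;> simp [ht]
  funext x
  apply Complex.ext
  · have := hmax (f x).re
    simp
    linarith
  · have := hmax (f x).im
    simp
    linarith

/-- Coincidence of two of the spaces propagates down to the exponent `1`. -/
theorem BMO_one_subset_of_subset {μ : Measure X} (hμ : BallsPosFinite μ) {p₁ p₂ : ℝ}
    (hp₁ : 1 ≤ p₁) (hp : p₁ < p₂) (h : BMO μ p₁ ⊆ BMO μ p₂) : BMO μ 1 ⊆ BMO μ p₂ := by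
  have hp0 : 0 < p₁ := by linarith
  have hr : 1 < p₂ / p₁ := (one_lt_div hp0).2 hp
  -- Scaling the inclusion by `α = (p₂ / p₁) ^ k / p₁` raises the exponent from `(p₂ / p₁) ^ k` to
  -- its next power. The truncation at `p₁` reflects the constraint `α ≤ 1`.
  have key : ∀ k : ℕ, BMO μ 1 ⊆ BMO μ (min ((p₂ / p₁) ^ k) p₁) := by
    intro k
    induction k with
    | zero => simp [hp₁]
    | succ k ih =>
      have hk1 : 1 ≤ (p₂ / p₁) ^ k := one_le_pow₀ hr.le
      rcases le_total ((p₂ / p₁) ^ k) p₁ with hk | hk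
      · rw [min_eq_left hk] at ih
        refine ih.trans ?_
        have hα1 : (p₂ / p₁) ^ k / p₁ ≤ 1 := (div_le_one hp0).2 hk
        have hαp : 0 < (p₂ / p₁) ^ k / p₁ := by positivity
        have e1 : (p₂ / p₁) ^ k / p₁ * p₁ = (p₂ / p₁) ^ k := div_mul_cancel₀ _ hp0.ne'
        have e2 : (p₂ / p₁) ^ k / p₁ * p₂ = (p₂ / p₁) ^ (k + 1) := by rw [pow_succ]; ring
        have : BMO μ ((p₂ / p₁) ^ k / p₁ * p₁) ⊆ BMO μ ((p₂ / p₁) ^ k / p₁ * p₂) :=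
          BMO_mul_subset_of_subset hμ hp₁ hp.le h
            (α := ⟨(p₂ / p₁) ^ k / p₁, hαp.le⟩) hαp hα1 (hk1.trans_eq e1.symm)
        rw [e1, e2] at this
        exact this.trans (BMO_antitone hμ (le_min (one_le_pow₀ hr.le) hp₁) (min_le_left _ _))
      · rw [min_eq_right hk] at ih
        exact ih.trans (BMO_antitone hμ (le_min (one_le_pow₀ hr.le) hp₁) (min_le_right _ _))
  obtain ⟨k, hk⟩ := pow_unbounded_of_one_lt p₁ hr
  have := key k
  rw [min_eq_right hk.le] at this
  exact this.trans h

theorem BMO_eq_one_of_eq {μ : Measure X} (hμ : BallsPosFinite μ) {p₁ p₂ : ℝ}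
    (hp₁ : 1 ≤ p₁) (hp : p₁ < p₂) (h : BMO μ p₁ ⊆ BMO μ p₂) : BMO μ p₂ = BMO μ 1 :=
  (BMO_antitone hμ le_rfl (hp₁.trans hp.le)).antisymm (BMO_one_subset_of_subset hμ hp₁ hp h)

theorem BMO_ssubset_of_ne {μ : Measure X} (hμ : BallsPosFinite μ) {p₁ p₂ : ℝ}
    (hp₁ : 1 ≤ p₁) (hp : p₁ < p₂) (h : BMO μ p₂ ≠ BMO μ 1) : BMO μ p₂ ⊂ BMO μ p₁ :=
  ⟨BMO_antitone hμ hp₁ hp.le, fun h' => h (BMO_eq_one_of_eq hμ hp₁ hp h')⟩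

theorem BMO_trichotomy {μ : Measure X} (hμ : BallsPosFinite μ) :
    BMOCaseA μ ∨ (∃ p₀ : ℝ, 1 < p₀ ∧ BMOCaseB μ p₀) ∨ (∃ p₀ : ℝ, 1 ≤ p₀ ∧ BMOCaseC μ p₀) := by
  set S : Set ℝ := {p | 1 ≤ p ∧ BMO μ p = BMO μ 1} with hS
  have h1S : (1 : ℝ) ∈ S := ⟨le_rfl, rfl⟩
  have hdown : ∀ p q, 1 ≤ p → p ≤ q → q ∈ S → BMO μ p = BMO μ 1 := fun p q hp hpq hq =>
    (BMO_antitone hμ le_rfl hp).antisymm (hq.2 ▸ BMO_antitone hμ hp hpq)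
  by_cases hb : BddAbove S
  · have hsup : 1 ≤ sSup S := le_csSup hb h1S
    by_cases hmem : sSup S ∈ S
    · refine Or.inr (Or.inr ⟨sSup S, hsup, fun p hp hpS => hdown p _ hp hpS hmem,
        fun p₁ p₂ hp₁ hp hp₂ => BMO_ssubset_of_ne hμ hp₁ hp fun heq => ?_⟩)
      exact hp₂.not_ge (le_csSup hb ⟨hp₁.trans hp.le, heq⟩)
    · have hlt : 1 < sSup S := lt_of_le_of_ne hsup fun h => hmem (h ▸ h1S)
      refine Or.inr (Or.inl ⟨sSup S, hlt, fun p hp hpS => ?_,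
        fun p₁ p₂ hp₁ hp hp₂ => BMO_ssubset_of_ne hμ hp₁ hp fun heq => ?_⟩)
      · obtain ⟨q, hq, hpq⟩ := exists_lt_of_lt_csSup ⟨1, h1S⟩ hpS
        exact hdown p q hp hpq.le hq
      · have hp₂S : p₂ ∈ S := ⟨hp₁.trans hp.le, heq⟩
        exact hmem ((le_csSup hb hp₂S).antisymm hp₂ ▸ hp₂S)
  · refine Or.inl ?_
    have hall : ∀ p, 1 ≤ p → BMO μ p = BMO μ 1 := by
      intro p hp
      obtain ⟨q, hq, hpq⟩ := not_bddAbove_iff.1 hb p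
      exact hdown p q hp hpq.le hq
    exact fun p₁ p₂ h₁ h₂ => (hall p₁ h₁).trans (hall p₂ h₂).symm

end Extrapolation

/-! ### The three cases exclude each other. -/

section Exclusivity

variable {X : Type*} [MetricSpace X] [MeasurableSpace X]

lemma not_caseA_and_caseB (μ : Measure X) :
    ¬ (BMOCaseA μ ∧ ∃ p₀ : ℝ, 1 < p₀ ∧ BMOCaseB μ p₀) := by
  rintro ⟨hA, p₀, hp₀, -, hB⟩
  exact (hB 1 p₀ le_rfl hp₀ le_rfl).ne (hA _ _ hp₀.le le_rfl)

lemma not_caseA_and_caseC (μ : Measure X) :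
    ¬ (BMOCaseA μ ∧ ∃ p₀ : ℝ, 1 ≤ p₀ ∧ BMOCaseC μ p₀) := by
  rintro ⟨hA, p₀, hp₀, -, hC⟩
  exact (hC 1 (p₀ + 1) le_rfl (by linarith) (by linarith)).ne (hA _ _ (by linarith) le_rfl)

lemma not_caseB_and_caseC (μ : Measure X) :
    ¬ ((∃ p₀ : ℝ, 1 < p₀ ∧ BMOCaseB μ p₀) ∧ ∃ p₀ : ℝ, 1 ≤ p₀ ∧ BMOCaseC μ p₀) := by
  rintro ⟨⟨p, hp, hB, hB'⟩, q, hq, hC, hC'⟩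
  rcases le_or_gt p q with h | h
  · exact (hB' 1 q le_rfl (hp.trans_le h) h).ne (hC q hq le_rfl)
  · obtain ⟨t, ht1, ht2⟩ := exists_between h
    exact (hC' 1 t le_rfl (hq.trans_lt ht1) ht1).ne (hB t (hq.trans ht1.le) ht2)

end Exclusivity

/-! ### The path space and its two kinds of balls. -/

/-- The natural numbers, with neighbours at distance `1` and all other pairs at distance `2`. -/
@[ext] structure PathSpace where
  /-- The point with a given index. -/
  vertex ::
  /-- The index of a point. -/
  index : ℕ

namespace PathSpace

instance : Countable PathSpace :=
  (show Function.Injective index from fun _ _ h => PathSpace.ext h).countable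

instance : Nonempty PathSpace := ⟨vertex 0⟩

/-- The distance of `PathSpace`. -/
def pathDist (j k : ℕ) : ℝ := if j = k then 0 else if j = k + 1 ∨ k = j + 1 then 1 else 2

lemma pathDist_triangle (i j k : ℕ) : pathDist i k ≤ pathDist i j + pathDist j k := by
  unfold pathDist
  split_ifs <;> first | (exfalso; omega) | norm_num

noncomputable instance : MetricSpace PathSpace where
  dist x y := pathDist x.index y.index
  dist_self x := if_pos rfl
  dist_comm x y := by
    unfold pathDist
    split_ifs <;> first | rfl | (exfalso; omega)
  dist_triangle x y z := pathDist_triangle _ _ _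
  eq_of_dist_eq_zero {x y} h := by
    change pathDist x.index y.index = 0 at h
    unfold pathDist at h
    split_ifs at h with h1 <;> first | exact PathSpace.ext h1 | norm_num at h

noncomputable instance : MeasurableSpace PathSpace := borel PathSpace

instance : BorelSpace PathSpace := ⟨rfl⟩

lemma dist_eq (x y : PathSpace) : dist x y = pathDist x.index y.index := rfl

lemma ball_eq_univ (c : PathSpace) {r : ℝ} (hr : 2 < r) : Metric.ball c r = Set.univ := by
  refine Set.eq_univ_of_forall fun x => Metric.mem_ball.2 (lt_of_le_of_lt ?_ hr)
  refine (dist_eq x c).trans_le ?_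
  unfold pathDist
  split_ifs <;> norm_num

/-- Balls are open, so even radius exactly `2` reaches only neighbours; any larger radius gives the
whole space. -/
lemma eq_or_of_mem_ball {c x : PathSpace} {r : ℝ} (hr : r ≤ 2) (hx : x ∈ Metric.ball c r) :
    x = c ∨ x = vertex (c.index + 1) ∨ c = vertex (x.index + 1) := by
  have h : pathDist x.index c.index < 2 := (Metric.mem_ball.1 hx).trans_le hr
  unfold pathDist at h
  split_ifs at h with h1 h2
  · exact Or.inl (PathSpace.ext h1)
  · exact Or.inr (h2.imp PathSpace.ext PathSpace.ext)
  · norm_num at h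

lemma self_mem_ball_two (k : ℕ) : (vertex k) ∈ Metric.ball (vertex k) 2 :=
  Metric.mem_ball_self two_pos

lemma succ_mem_ball_two (k : ℕ) :
    (vertex (k + 1)) ∈ Metric.ball (vertex k) 2 := by
  refine Metric.mem_ball.2 ((dist_eq _ _).trans_lt ?_)
  simp [pathDist]

/-- The measure on `PathSpace` with the given weights of points. -/
noncomputable def weightMeasure (u : ℕ → ℝ) : Measure PathSpace :=
  Measure.sum fun k : ℕ => ENNReal.ofReal (u k) • Measure.dirac (vertex k)

lemma lintegral_weightMeasure (u : ℕ → ℝ) (g : PathSpace → ℝ≥0∞) :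
    ∫⁻ x, g x ∂weightMeasure u = ∑' k : ℕ, ENNReal.ofReal (u k) * g (vertex k) := by
  simp [weightMeasure, lintegral_sum_measure, lintegral_smul_measure, lintegral_dirac]

lemma weightMeasure_singleton (u : ℕ → ℝ) (k : ℕ) :
    weightMeasure u {vertex k} = ENNReal.ofReal (u k) := by
  rw [weightMeasure, Measure.sum_apply _ (measurableSet_singleton _),
    tsum_eq_single (f := fun j => (ENNReal.ofReal (u j) • Measure.dirac (vertex j)) {vertex k}) k]
  · simp
  · intro j hj
    simp only [Measure.smul_apply, smul_eq_mul, mul_eq_zero]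
    right
    rw [Measure.dirac_apply' _ (measurableSet_singleton _)]
    have hne : vertex j ∉ ({vertex k} : Set PathSpace) := fun h => hj (congrArg index h)
    simp [hne]

/-! ### BMO on the weighted path as a moment condition. -/

/-- Weights that are positive and nonincreasing, do not decay too fast, and have a finite first
moment. -/
structure IsPathWeight (u : ℕ → ℝ) : Prop where
  pos : ∀ k, 0 < u k
  succ_le : ∀ k, u (k + 1) ≤ u k
  le_succ : ∃ K : ℝ, 0 ≤ K ∧ ∀ k, u k ≤ K * u (k + 1)
  summable_mul : Summable fun k : ℕ => ((k : ℝ) + 2) * u k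

namespace IsPathWeight

variable {u : ℕ → ℝ} (hu : IsPathWeight u)

include hu

lemma lintegral_ne_top {s : ℕ → ℝ} (hs0 : ∀ k, 0 ≤ s k) (hs : Summable fun k => u k * s k)
    {g : PathSpace → ℝ≥0∞} (hg : ∀ k : ℕ, g (vertex k) ≤ ENNReal.ofReal (s k)) :
    ∫⁻ x, g x ∂weightMeasure u ≠ ∞ := by
  have h : ∫⁻ x, g x ∂weightMeasure u ≤ ∑' k, ENNReal.ofReal (u k * s k) := by
    rw [lintegral_weightMeasure]
    refine ENNReal.tsum_le_tsum fun k => ?_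
    rw [ENNReal.ofReal_mul (hu.pos k).le]
    gcongr
    exact hg k
  rw [← ENNReal.ofReal_tsum_of_nonneg (fun k => mul_nonneg (hu.pos k).le (hs0 k)) hs] at h
  exact ne_top_of_le_ne_top ENNReal.ofReal_ne_top h

lemma isFiniteMeasure : IsFiniteMeasure (weightMeasure u) := by
  refine ⟨lt_top_iff_ne_top.2 ?_⟩
  rw [← lintegral_one]
  refine hu.lintegral_ne_top (s := fun k => (k : ℝ) + 2) (fun k => by positivity)
    (by simpa [mul_comm] using hu.summable_mul) fun k => ?_
  rw [← ENNReal.ofReal_one]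
  exact ENNReal.ofReal_le_ofReal (by linarith [Nat.cast_nonneg (α := ℝ) k])

lemma ballsPosFinite : BallsPosFinite (weightMeasure u) := by
  have := hu.isFiniteMeasure
  refine fun c r hr => ⟨?_, measure_lt_top _ _⟩
  refine lt_of_lt_of_le ?_ (measure_mono (Set.singleton_subset_iff.2
    (Metric.mem_ball_self (x := c) hr)))
  exact (ENNReal.ofReal_pos.2 (hu.pos c.index)).trans_eq (weightMeasure_singleton u c.index).symm

lemma exists_measure_ball_le : ∃ M : ℝ≥0∞, M ≠ ∞ ∧ ∀ k : ℕ,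
    weightMeasure u (Metric.ball (vertex k) 2)
      ≤ M * weightMeasure u {vertex k} ∧
    weightMeasure u (Metric.ball (vertex k) 2)
      ≤ M * weightMeasure u {vertex (k + 1)} := by
  obtain ⟨K, hK, hKu⟩ := hu.le_succ
  -- The left neighbour costs `K * u k`, the other two points at most `2 * u k`. A further factor
  -- `K` passes from `u k` to `u (k + 1)`.
  refine ⟨ENNReal.ofReal (K + 2) + ENNReal.ofReal ((K + 2) * K), by simp, fun k => ?_⟩
  have h : weightMeasure u (Metric.ball (vertex k) 2)
      ≤ ENNReal.ofReal ((K + 2) * u k) := by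
    have hsub : Metric.ball (vertex k) 2 ⊆ {vertex (k - 1)} ∪
        ({vertex k} ∪ {vertex (k + 1)}) := by
      intro x hx
      rcases eq_or_of_mem_ball le_rfl hx with h | h | h
      · exact Or.inr (Or.inl h)
      · exact Or.inr (Or.inr h)
      · exact Or.inl (PathSpace.ext (show x.index = k - 1 by have := congrArg index h; simp at this; omega))
    refine (measure_mono hsub).trans ((measure_union_le _ _).trans
      ((add_le_add_right (measure_union_le _ _) _).trans ?_))
    rw [weightMeasure_singleton, weightMeasure_singleton, weightMeasure_singleton,
      ← ENNReal.ofReal_add (hu.pos _).le (hu.pos _).le,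
      ← ENNReal.ofReal_add (hu.pos _).le (add_nonneg (hu.pos _).le (hu.pos _).le)]
    refine ENNReal.ofReal_le_ofReal ?_
    have h1 := hu.succ_le k
    have h3 := hu.pos k
    rcases k with _ | k
    -- At `k = 0` truncated subtraction counts vertex `0` twice; the bound survives because `u 0 ≤ K
    -- * u 0`.
    · simp only [zero_add, Nat.zero_sub] at *
      have h4 := hKu 0
      have h5 : u 0 ≤ K * u 0 := h4.trans (mul_le_mul_of_nonneg_left h1 hK)
      linarith
    · have := hKu k
      simp only [Nat.add_sub_cancel] at *
      linarith
  have hk := hu.pos k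
  rw [weightMeasure_singleton, weightMeasure_singleton]
  constructor
  · refine h.trans ?_
    rw [ENNReal.ofReal_mul (by linarith)]
    gcongr
    exact le_self_add
  · refine h.trans (le_trans ?_ (mul_le_mul_left le_add_self _))
    rw [← ENNReal.ofReal_mul (by positivity)]
    refine ENNReal.ofReal_le_ofReal ?_
    rw [mul_assoc]
    exact mul_le_mul_of_nonneg_left (hKu k) (by linarith)

/-- A point carrying at least the fraction `1 / M` of the ball cannot deviate by more than `M` times
the mean oscillation. -/
lemma enorm_sub_le {f : PathSpace → ℂ} {c y : PathSpace} {r : ℝ} (hr : 0 < r)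
    (hy : y ∈ Metric.ball c r) {C M : ℝ≥0∞} {z : ℂ}
    (hM : weightMeasure u (Metric.ball c r) ≤ M * weightMeasure u {y})
    (hC : ∫⁻ x, ‖f x - z‖ₑ ∂ballProb (weightMeasure u) c r ≤ C) : ‖f y - z‖ₑ ≤ C * M := by
  have hfin := hu.isFiniteMeasure
  have hb := hu.ballsPosFinite c r hr
  have hy0 : weightMeasure u {y} ≠ 0 := by
    exact ((ENNReal.ofReal_pos.2 (hu.pos y.index)).trans_eq
      (weightMeasure_singleton u y.index).symm).ne'
  rw [ballProb, lintegral_smul_measure, smul_eq_mul, mul_comm, ← div_eq_mul_inv,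
    ENNReal.div_le_iff hb.1.ne' hb.2.ne] at hC
  have h1 : ‖f y - z‖ₑ * weightMeasure u {y} ≤ C * M * weightMeasure u {y} := by
    calc ‖f y - z‖ₑ * weightMeasure u {y} = ∫⁻ x in {y}, ‖f x - z‖ₑ ∂weightMeasure u := by
          rw [lintegral_singleton]
      _ ≤ ∫⁻ x in Metric.ball c r, ‖f x - z‖ₑ ∂weightMeasure u :=
          lintegral_mono_set (Set.singleton_subset_iff.2 hy)
      _ ≤ C * weightMeasure u (Metric.ball c r) := hC
      _ ≤ C * (M * weightMeasure u {y}) := by gcongr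
      _ = _ := (mul_assoc _ _ _).symm
  exact (ENNReal.mul_le_mul_iff_left hy0 (measure_ne_top _ _)).1 h1

lemma exists_norm_sub_succ_le {f : PathSpace → ℂ} (hf : f ∈ BMO (weightMeasure u) 1) :
    ∃ D : ℝ, 0 ≤ D ∧ ∀ k : ℕ,
      ‖f (vertex (k + 1)) - f (vertex k)‖ ≤ D := by
  obtain ⟨-, a, C, hC, ha⟩ := (mem_BMO_iff hu.ballsPosFinite le_rfl).1 hf
  obtain ⟨M, hM, hMu⟩ := hu.exists_measure_ball_le
  have htop : C * M + C * M ≠ ∞ :=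
    ENNReal.add_ne_top.2 ⟨ENNReal.mul_ne_top hC hM, ENNReal.mul_ne_top hC hM⟩
  refine ⟨(C * M + C * M).toReal, ENNReal.toReal_nonneg, fun k => ?_⟩
  have hint := ha (vertex k) 2 two_pos
  simp only [ENNReal.rpow_one] at hint
  have h1 := hu.enorm_sub_le two_pos (self_mem_ball_two k) (hMu k).1 hint
  have h2 := hu.enorm_sub_le two_pos (succ_mem_ball_two k) (hMu k).2 hint
  have h3 : ‖f (vertex (k + 1)) - f (vertex k)‖ₑ ≤ C * M + C * M := by
    refine le_trans ((le_of_eq ?_).trans (_root_.enorm_sub_le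
      (a := f (vertex (k + 1)) - a (vertex k) 2)
      (b := f (vertex k) - a (vertex k) 2))) (add_le_add h2 h1)
    congr 1; ring
  rw [← ofReal_norm] at h3
  exact (ENNReal.ofReal_le_iff_le_toReal htop).1 h3

omit hu in
lemma norm_sub_zero_le {f : PathSpace → ℂ} {D : ℝ}
    (hf : ∀ k : ℕ, ‖f (vertex (k + 1)) - f (vertex k)‖ ≤ D) (k : ℕ) :
    ‖f (vertex k) - f (vertex 0)‖ ≤ D * k := by
  induction k with
  | zero => simp
  | succ k ih =>
    push_cast
    calc ‖f (vertex (k + 1)) - f (vertex 0)‖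
        ≤ _ := norm_sub_le_norm_sub_add_norm_sub _ (f (vertex k)) _
      _ ≤ D * (k + 1) := by linarith [hf k]

lemma mem_BMO_of_norm_sub_succ_le {p : ℝ} (hp : 1 ≤ p) {f : PathSpace → ℂ}
    (hfi : IntegrableOnBalls (weightMeasure u) f) {D : ℝ} (hD : 0 ≤ D)
    (hf : ∀ k : ℕ, ‖f (vertex (k + 1)) - f (vertex k)‖ ≤ D)
    (hs : Summable fun k : ℕ => ((k : ℝ) + 2) ^ p * u k) : f ∈ BMO (weightMeasure u) p := by
  have hp0 : 0 ≤ p := by linarith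
  refine (mem_BMO_iff hu.ballsPosFinite hp).2 ⟨hfi,
    -- Small balls contain only neighbours of `c`, where `f` is within `D` of `f c`. All larger
    -- balls are the whole space, so one global moment suffices.
    fun c r => if r ≤ 2 then f c else f (vertex 0), ?_⟩
  set I := ∫⁻ x, ‖f x - f (vertex 0)‖ₑ ^ p ∂weightMeasure u
  have hI : I ≠ ∞ := by
    refine hu.lintegral_ne_top (s := fun k => D ^ p * ((k : ℝ) + 2) ^ p)
      (fun k => by positivity) ?_ fun k => ?_
    · exact (hs.mul_left (D ^ p)).congr fun k => by ring
    · rw [← Real.mul_rpow hD (by positivity), ← ENNReal.ofReal_rpow_of_nonneg (by positivity) hp0]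
      refine ENNReal.rpow_le_rpow ?_ hp0
      rw [← ofReal_norm]
      refine ENNReal.ofReal_le_ofReal ((norm_sub_zero_le hf k).trans ?_)
      gcongr
      linarith
  have hb := hu.ballsPosFinite
  have hU : weightMeasure u Set.univ ≠ 0 := by
    rw [← ball_eq_univ (vertex 0) (by norm_num : (2 : ℝ) < 3)]
    exact (hb _ _ (by norm_num)).1.ne'
  refine ⟨ENNReal.ofReal D ^ p + (weightMeasure u Set.univ)⁻¹ * I, ?_, fun c r hr => ?_⟩
  · exact ENNReal.add_ne_top.2 ⟨ENNReal.rpow_ne_top_of_nonneg hp0 ENNReal.ofReal_ne_top,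
      ENNReal.mul_ne_top (ENNReal.inv_ne_top.2 hU) hI⟩
  by_cases h2 : r ≤ 2
  · refine le_trans ?_ le_self_add
    rw [ballProb, lintegral_smul_measure, smul_eq_mul]
    simp only [if_pos h2]
    have hle : ∫⁻ x in Metric.ball c r, ‖f x - f c‖ₑ ^ p ∂weightMeasure u
        ≤ ∫⁻ _ in Metric.ball c r, ENNReal.ofReal D ^ p ∂weightMeasure u := by
      refine setLIntegral_mono' measurableSet_ball fun x hx => ?_
      refine ENNReal.rpow_le_rpow ?_ hp0
      rw [← ofReal_norm]
      refine ENNReal.ofReal_le_ofReal ?_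
      rcases eq_or_of_mem_ball h2 hx with h | h | h
      · rw [h, sub_self, norm_zero]; exact hD
      · rw [h]
        exact hf c.index
      · rw [h, norm_sub_rev]
        exact hf x.index
    rw [setLIntegral_const] at hle
    calc _ ≤ (weightMeasure u (Metric.ball c r))⁻¹
          * (ENNReal.ofReal D ^ p * weightMeasure u (Metric.ball c r)) := by gcongr
      _ = ENNReal.ofReal D ^ p := by
        rw [mul_left_comm, ENNReal.inv_mul_cancel (hb c r hr).1.ne' (hb c r hr).2.ne, mul_one]
  · refine le_trans ?_ le_add_self
    rw [ballProb, ball_eq_univ c (not_le.1 h2), lintegral_smul_measure, smul_eq_mul,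
      Measure.restrict_univ]
    simp only [if_neg h2]
    exact le_rfl

theorem BMO_eq_one {p : ℝ} (hp : 1 ≤ p) (hs : Summable fun k : ℕ => ((k : ℝ) + 2) ^ p * u k) :
    BMO (weightMeasure u) p = BMO (weightMeasure u) 1 := by
  refine (BMO_antitone hu.ballsPosFinite le_rfl hp).antisymm fun f hf => ?_
  obtain ⟨D, hD, hfD⟩ := hu.exists_norm_sub_succ_le hf
  exact hu.mem_BMO_of_norm_sub_succ_le hp hf.1 hD hfD hs

omit hu in
/-- The coordinate function of `PathSpace`. -/
def _root_.PathSpace.coord (x : PathSpace) : ℂ := (x.index : ℂ) + 2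

omit hu in
lemma enorm_coord (k : ℕ) : ‖coord (vertex k)‖ₑ = ENNReal.ofReal ((k : ℝ) + 2) := by
  rw [← ofReal_norm]
  congr 1
  have : coord (vertex k) = (((k : ℝ) + 2 : ℝ) : ℂ) := by simp [coord]
  rw [this, Complex.norm_real, Real.norm_of_nonneg (by positivity)]

lemma coord_mem_BMO_one : coord ∈ BMO (weightMeasure u) 1 := by
  refine hu.mem_BMO_of_norm_sub_succ_le le_rfl (fun c r _ => ?_) zero_le_one (fun k => ?_)
    (by simpa using hu.summable_mul)
  · refine Integrable.integrableOn ⟨(measurable_of_countable _).aestronglyMeasurable, ?_⟩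
    refine lt_top_iff_ne_top.2 (hu.lintegral_ne_top (s := fun k => (k : ℝ) + 2)
      (fun k => by positivity) (by simpa [mul_comm] using hu.summable_mul)
      fun k => (enorm_coord k).le)
  · have : coord (vertex (k + 1)) - coord (vertex k) = 1 := by
      change (((k + 1 : ℕ) : ℂ) + 2) - ((k : ℂ) + 2) = 1
      push_cast; ring
    rw [this, norm_one]

/-- The coordinate function is the extremal case of linear growth: it lies in `BMO^1`, but the
whole-space ball would force its `p`-th moment to be finite. -/
theorem BMO_ne_one {p : ℝ} (hp : 1 ≤ p) (hs : ¬ Summable fun k : ℕ => ((k : ℝ) + 2) ^ p * u k) :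
    BMO (weightMeasure u) p ≠ BMO (weightMeasure u) 1 := by
  intro heq
  have hp0 : 0 ≤ p := by linarith
  have hmem : coord ∈ BMO (weightMeasure u) p := heq ▸ hu.coord_mem_BMO_one
  obtain ⟨-, a, C, hC, ha⟩ := (mem_BMO_iff hu.ballsPosFinite hp).1 hmem
  have hfin := hu.isFiniteMeasure
  set z := a (vertex 0) 3
  have h1 := ha (vertex 0) 3 (by norm_num)
  have hb := hu.ballsPosFinite (vertex 0) 3 (by norm_num)
  rw [ballProb, lintegral_smul_measure, smul_eq_mul, mul_comm, ← div_eq_mul_inv,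
    ENNReal.div_le_iff hb.1.ne' hb.2.ne, ball_eq_univ _ (by norm_num : (2 : ℝ) < 3),
    Measure.restrict_univ] at h1
  have htop : (2 : ℝ≥0∞) ^ (p - 1) ≠ ∞ := ENNReal.rpow_ne_top_of_nonneg (by linarith) (by simp)
  have h2 : ∫⁻ x, ‖coord x‖ₑ ^ p ∂weightMeasure u ≠ ∞ := by
    have hle : ∫⁻ x, ‖coord x‖ₑ ^ p ∂weightMeasure u
        ≤ ∫⁻ x, 2 ^ (p - 1) * (‖coord x - z‖ₑ ^ p + ‖z‖ₑ ^ p) ∂weightMeasure u := by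
      refine lintegral_mono fun x => le_trans (ENNReal.rpow_le_rpow ?_ hp0)
        (ENNReal.rpow_add_le_mul_rpow_add_rpow _ _ hp)
      refine (le_of_eq ?_).trans (enorm_add_le _ _)
      congr 1; ring
    refine ne_top_of_le_ne_top ?_ hle
    rw [lintegral_const_mul' _ _ htop, lintegral_add_right _ measurable_const, lintegral_const]
    refine ENNReal.mul_ne_top htop (ENNReal.add_ne_top.2 ⟨?_, ?_⟩)
    · exact ne_top_of_le_ne_top (ENNReal.mul_ne_top hC (measure_ne_top _ _)) h1
    · exact ENNReal.mul_ne_top (ENNReal.rpow_ne_top_of_nonneg hp0 enorm_ne_top)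
        (measure_ne_top _ _)
  rw [lintegral_weightMeasure] at h2
  refine hs ((ENNReal.summable_toReal h2).congr fun k => ?_)
  rw [enorm_coord, ENNReal.ofReal_rpow_of_nonneg (by positivity) hp0,
    ← ENNReal.ofReal_mul (hu.pos k).le, ENNReal.toReal_ofReal, mul_comm]
  exact mul_nonneg (hu.pos k).le (by positivity)

theorem caseA (h : ∀ p : ℝ, 1 ≤ p → Summable fun k : ℕ => ((k : ℝ) + 2) ^ p * u k) :
    BMOCaseA (weightMeasure u) := fun p₁ p₂ h₁ h₂ =>
  (hu.BMO_eq_one h₁ (h p₁ h₁)).trans (hu.BMO_eq_one h₂ (h p₂ h₂)).symm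

theorem caseB {p₀ : ℝ}
    (h : ∀ p : ℝ, 1 ≤ p → ((Summable fun k : ℕ => ((k : ℝ) + 2) ^ p * u k) ↔ p < p₀)) :
    BMOCaseB (weightMeasure u) p₀ :=
  ⟨fun p hp hpp => hu.BMO_eq_one hp ((h p hp).2 hpp), fun _ p₂ h₁ h₁₂ h₂ =>
    BMO_ssubset_of_ne hu.ballsPosFinite h₁ h₁₂
      (hu.BMO_ne_one (h₁.trans h₁₂.le) fun hs => ((h p₂ (h₁.trans h₁₂.le)).1 hs).not_ge h₂)⟩

theorem caseC {p₀ : ℝ}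
    (h : ∀ p : ℝ, 1 ≤ p → ((Summable fun k : ℕ => ((k : ℝ) + 2) ^ p * u k) ↔ p ≤ p₀)) :
    BMOCaseC (weightMeasure u) p₀ :=
  ⟨fun p hp hpp => hu.BMO_eq_one hp ((h p hp).2 hpp), fun _ p₂ h₁ h₁₂ h₂ =>
    BMO_ssubset_of_ne hu.ballsPosFinite h₁ h₁₂
      (hu.BMO_ne_one (h₁.trans h₁₂.le) fun hs => ((h p₂ (h₁.trans h₁₂.le)).1 hs).not_gt h₂)⟩

end IsPathWeight

end PathSpace

/-! ### Weights realizing each threshold. -/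

namespace PathSpace

lemma summable_add_two_rpow {p : ℝ} : (Summable fun k : ℕ => ((k : ℝ) + 2) ^ p) ↔ p < -1 := by
  rw [← Real.summable_nat_rpow, ← summable_nat_add_iff (f := fun n : ℕ => (n : ℝ) ^ p) 2]
  simp

lemma add_two_rpow_mul_rpow (p q : ℝ) (k : ℕ) :
    ((k : ℝ) + 2) ^ p * ((k : ℝ) + 2) ^ q = ((k : ℝ) + 2) ^ (p + q) :=
  (Real.rpow_add (by positivity) p q).symm

lemma isPathWeight_geometric : IsPathWeight fun k => (1 / 2 : ℝ) ^ k where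
  pos k := by positivity
  succ_le k := pow_le_pow_of_le_one (by norm_num) (by norm_num) (Nat.le_succ k)
  le_succ := ⟨2, by norm_num, fun k => by rw [pow_succ]; linarith⟩
  summable_mul := by
    have h1 := summable_pow_mul_geometric_of_norm_lt_one 1 (r := (1 / 2 : ℝ)) (by norm_num)
    have h0 := summable_geometric_of_lt_one (r := (1 / 2 : ℝ)) (by norm_num) (by norm_num)
    exact (h1.add (h0.mul_left 2)).congr fun k => by ring

lemma summable_add_two_rpow_mul_geometric (p : ℝ) :
    Summable fun k : ℕ => ((k : ℝ) + 2) ^ p * (1 / 2 : ℝ) ^ k := by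
  have h := (summable_nat_add_iff 2).2
    (summable_pow_mul_geometric_of_norm_lt_one ⌈p⌉₊ (r := (1 / 2 : ℝ)) (by norm_num))
  -- The factor `4` undoes the shift by two in `(1 / 2) ^ (k + 2)`.
  refine Summable.of_nonneg_of_le (fun k => by positivity) (fun k => ?_) (h.mul_left 4)
  have h1 : ((k : ℝ) + 2) ^ p ≤ ((k : ℝ) + 2) ^ ⌈p⌉₊ := by
    rw [← Real.rpow_natCast]
    exact Real.rpow_le_rpow_of_exponent_le (by linarith [Nat.cast_nonneg (α := ℝ) k])
      (Nat.le_ceil p)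
  calc ((k : ℝ) + 2) ^ p * (1 / 2 : ℝ) ^ k ≤ ((k : ℝ) + 2) ^ ⌈p⌉₊ * (1 / 2 : ℝ) ^ k := by gcongr
    _ = _ := by push_cast; ring

lemma add_two_rpow_le (s : ℝ) (hs : 0 ≤ s) (k : ℕ) :
    ((k : ℝ) + 2) ^ (-s) ≤ 2 ^ s * (((k + 1 : ℕ) : ℝ) + 2) ^ (-s) := by
  rw [Real.rpow_neg (by positivity), Real.rpow_neg (by positivity), ← div_eq_mul_inv,
    inv_eq_one_div, div_le_div_iff₀ (by positivity) (by positivity), one_mul,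
    ← Real.mul_rpow (by norm_num) (by positivity)]
  refine Real.rpow_le_rpow (by positivity) ?_ hs
  push_cast
  linarith [Nat.cast_nonneg (α := ℝ) k]

lemma add_two_rpow_succ_le (s : ℝ) (hs : 0 ≤ s) (k : ℕ) :
    (((k + 1 : ℕ) : ℝ) + 2) ^ (-s) ≤ ((k : ℝ) + 2) ^ (-s) :=
  Real.rpow_le_rpow_of_nonpos (by positivity) (by push_cast; linarith) (by linarith)

lemma isPathWeight_rpow {p₀ : ℝ} (hp₀ : 1 < p₀) :
    IsPathWeight fun k => ((k : ℝ) + 2) ^ (-(p₀ + 1)) where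
  pos k := by positivity
  succ_le := add_two_rpow_succ_le _ (by linarith)
  le_succ := ⟨2 ^ (p₀ + 1), by positivity, add_two_rpow_le _ (by linarith)⟩
  summable_mul := by
    refine (summable_add_two_rpow (p := 1 + -(p₀ + 1)) |>.2 (by linarith)).congr fun k => ?_
    rw [← add_two_rpow_mul_rpow, Real.rpow_one]

lemma summable_rpow_iff {p p₀ : ℝ} :
    (Summable fun k : ℕ => ((k : ℝ) + 2) ^ p * ((k : ℝ) + 2) ^ (-(p₀ + 1))) ↔ p < p₀ := by
  simp only [add_two_rpow_mul_rpow, summable_add_two_rpow]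
  constructor <;> intro h <;> linarith

lemma log_add_two_pos (k : ℕ) : 0 < Real.log ((k : ℝ) + 2) :=
  Real.log_pos (by linarith [Nat.cast_nonneg (α := ℝ) k])

/-- Cauchy condensation compares the series with `∑ 1 / (k log 2) ^ 2`. -/
lemma summable_inv_mul_inv_log_sq :
    Summable fun k : ℕ => ((k : ℝ) + 2)⁻¹ * (Real.log ((k : ℝ) + 2) ^ 2)⁻¹ := by
  have hmono : ∀ m n : ℕ, m ≤ n → ((n : ℝ) + 2)⁻¹ * (Real.log ((n : ℝ) + 2) ^ 2)⁻¹
      ≤ ((m : ℝ) + 2)⁻¹ * (Real.log ((m : ℝ) + 2) ^ 2)⁻¹ := by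
    intro m n hmn
    have := log_add_two_pos m
    have hmn' : (m : ℝ) ≤ n := by exact_mod_cast hmn
    gcongr
  refine (summable_condensed_iff_of_nonneg (fun n => ?_) fun m n _ => hmono m n).1 ?_
  · have := log_add_two_pos n
    positivity
  have hz : Summable fun k : ℕ => ((Real.log 2) ^ 2)⁻¹ * (((k + 1 : ℕ) : ℝ) ^ 2)⁻¹ :=
    Summable.mul_left _ ((summable_nat_add_iff 1).2 (Real.summable_nat_pow_inv.2 one_lt_two))
  -- The index `0` is dropped because the comparison term there would be `0⁻¹ = 0`.
  rw [← summable_nat_add_iff 1]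
  refine Summable.of_nonneg_of_le (fun k => ?_) (fun k => ?_) hz
  · have := log_add_two_pos (2 ^ (k + 1))
    positivity
  · have hl2 : 0 < Real.log 2 := Real.log_pos one_lt_two
    have hlog : ((k + 1 : ℕ) : ℝ) * Real.log 2 ≤ Real.log (((2 ^ (k + 1) : ℕ) : ℝ) + 2) := by
      rw [← Real.log_pow]
      exact Real.log_le_log (by positivity) (by push_cast; linarith)
    have h1 : (2 : ℝ) ^ (k + 1) * (((2 ^ (k + 1) : ℕ) : ℝ) + 2)⁻¹ ≤ 1 := by
      rw [← div_eq_mul_inv, div_le_one (by positivity)]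
      push_cast; linarith
    have h2 : (Real.log (((2 ^ (k + 1) : ℕ) : ℝ) + 2) ^ 2)⁻¹
        ≤ ((Real.log 2) ^ 2)⁻¹ * (((k + 1 : ℕ) : ℝ) ^ 2)⁻¹ := by
      rw [← mul_inv, ← mul_pow, mul_comm (Real.log 2)]
      gcongr
    rw [← mul_assoc]
    exact (mul_le_of_le_one_left (by positivity) h1).trans h2

/-- Since `log² x = o(x ^ ε)`, the terms eventually dominate the harmonic series. -/
lemma not_summable_rpow_mul_inv_log_sq {ε : ℝ} (hε : 0 < ε) :
    ¬ Summable fun k : ℕ => ((k : ℝ) + 2) ^ (ε - 1) * (Real.log ((k : ℝ) + 2) ^ 2)⁻¹ := by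
  intro h
  have hlit := (isLittleO_log_rpow_rpow_atTop 2 hε).bound one_pos
  have hev : ∀ᶠ k : ℕ in Filter.cofinite, ‖((k : ℝ) + 2) ^ (-1 : ℝ)‖
      ≤ ((k : ℝ) + 2) ^ (ε - 1) * (Real.log ((k : ℝ) + 2) ^ 2)⁻¹ := by
    rw [Nat.cofinite_eq_atTop]
    have ht : Filter.Tendsto (fun k : ℕ => (k : ℝ) + 2) Filter.atTop Filter.atTop :=
      Filter.tendsto_atTop_add_const_right _ _ tendsto_natCast_atTop_atTop
    filter_upwards [ht.eventually hlit] with k hk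
    have hl := log_add_two_pos k
    have hx : (0 : ℝ) < (k : ℝ) + 2 := by positivity
    rw [Real.norm_of_nonneg (by positivity), Real.norm_of_nonneg (by positivity), one_mul,
      Real.rpow_two] at hk
    rw [Real.norm_of_nonneg (by positivity), ← div_eq_mul_inv, le_div_iff₀ (by positivity),
      sub_eq_add_neg, Real.rpow_add hx, mul_comm]
    gcongr
  exact absurd (summable_add_two_rpow.1 (Summable.of_norm_bounded_eventually h hev))
    (lt_irrefl _)

/-- The factor `log⁻²` makes the series converge at the endpoint `p = p₀` without affecting larger
exponents, which turns case (b) into case (c). -/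
lemma isPathWeight_log {p₀ : ℝ} (hp₀ : 1 ≤ p₀) :
    IsPathWeight fun k => ((k : ℝ) + 2) ^ (-(p₀ + 1)) * (Real.log ((k : ℝ) + 2) ^ 2)⁻¹ where
  pos k := by
    have := log_add_two_pos k
    positivity
  succ_le k := by
    have := log_add_two_pos k
    have h2 : Real.log ((k : ℝ) + 2) ≤ Real.log (((k + 1 : ℕ) : ℝ) + 2) :=
      Real.log_le_log (by positivity) (by push_cast; linarith)
    exact mul_le_mul (add_two_rpow_succ_le _ (by linarith) k) (by gcongr) (by positivity)
      (by positivity)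
  le_succ := by
    refine ⟨2 ^ (p₀ + 1) * 4, by positivity, fun k => ?_⟩
    have h0 := log_add_two_pos k
    have h1 := log_add_two_pos (k + 1)
    -- This is `k + 3 ≤ (k + 2) ^ 2`; squaring the logarithms gives the factor `4`.
    have h2 : Real.log (((k + 1 : ℕ) : ℝ) + 2) ≤ 2 * Real.log ((k : ℝ) + 2) := by
      rw [← Nat.cast_two (R := ℝ), ← Real.log_pow]
      refine Real.log_le_log (by positivity) ?_
      push_cast
      nlinarith [Nat.cast_nonneg (α := ℝ) k]
    have h3 : (Real.log ((k : ℝ) + 2) ^ 2)⁻¹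
        ≤ 4 * (Real.log (((k + 1 : ℕ) : ℝ) + 2) ^ 2)⁻¹ := by
      rw [← div_eq_mul_inv, inv_eq_one_div, div_le_div_iff₀ (by positivity) (by positivity)]
      nlinarith
    calc _ ≤ (2 ^ (p₀ + 1) * (((k + 1 : ℕ) : ℝ) + 2) ^ (-(p₀ + 1)))
          * (4 * (Real.log (((k + 1 : ℕ) : ℝ) + 2) ^ 2)⁻¹) :=
          mul_le_mul (add_two_rpow_le _ (by linarith) k) h3 (by positivity) (by positivity)
      _ = _ := by ring
  summable_mul := by
    refine Summable.of_nonneg_of_le (fun k => ?_) (fun k => ?_) summable_inv_mul_inv_log_sq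
    · have := log_add_two_pos k
      positivity
    · have := log_add_two_pos k
      rw [← mul_assoc]
      gcongr
      nth_rewrite 1 [← Real.rpow_one ((k : ℝ) + 2)]
      rw [add_two_rpow_mul_rpow, ← Real.rpow_neg_one]
      exact Real.rpow_le_rpow_of_exponent_le (by linarith [Nat.cast_nonneg (α := ℝ) k])
        (by linarith)

lemma summable_log_iff {p p₀ : ℝ} :
    (Summable fun k : ℕ => ((k : ℝ) + 2) ^ p *
      (((k : ℝ) + 2) ^ (-(p₀ + 1)) * (Real.log ((k : ℝ) + 2) ^ 2)⁻¹)) ↔ p ≤ p₀ := by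
  simp only [← mul_assoc, add_two_rpow_mul_rpow]
  constructor
  · intro h
    by_contra! hlt
    refine not_summable_rpow_mul_inv_log_sq (sub_pos.2 hlt) ?_
    rwa [show p - p₀ - 1 = p + -(p₀ + 1) by ring]
  · intro h
    refine Summable.of_nonneg_of_le (fun k => ?_) (fun k => ?_) summable_inv_mul_inv_log_sq
    · have := log_add_two_pos k
      positivity
    · have := log_add_two_pos k
      gcongr
      rw [← Real.rpow_neg_one]
      exact Real.rpow_le_rpow_of_exponent_le (by linarith [Nat.cast_nonneg (α := ℝ) k])
        (by linarith)

lemma existsMetricMeasureSpace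
    {P : ∀ (X : Type) [MetricSpace X] [MeasurableSpace X], Measure X → Prop} {u : ℕ → ℝ}
    (hu : IsPathWeight u) (h : P PathSpace (weightMeasure u)) : ExistsMetricMeasureSpace P :=
  ⟨PathSpace, inferInstance, inferInstance, inferInstance, weightMeasure u, inferInstance,
    hu.ballsPosFinite, h⟩

end PathSpace

theorem theorem1 :
    -- every metric measure space is in exactly one of the three cases
    (∀ (X : Type*) [MetricSpace X] [MeasurableSpace X] [BorelSpace X] (μ : Measure X),
      BallsPosFinite μ →
        (BMOCaseA μ ∨ (∃ p₀ : ℝ, 1 < p₀ ∧ BMOCaseB μ p₀) ∨ (∃ p₀ : ℝ, 1 ≤ p₀ ∧ BMOCaseC μ p₀)) ∧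
        ¬ (BMOCaseA μ ∧ ∃ p₀ : ℝ, 1 < p₀ ∧ BMOCaseB μ p₀) ∧
        ¬ (BMOCaseA μ ∧ ∃ p₀ : ℝ, 1 ≤ p₀ ∧ BMOCaseC μ p₀) ∧
        ¬ ((∃ p₀ : ℝ, 1 < p₀ ∧ BMOCaseB μ p₀) ∧ ∃ p₀ : ℝ, 1 ≤ p₀ ∧ BMOCaseC μ p₀)) ∧
    -- every case, with every admissible `p₀`, is realized
    ExistsMetricMeasureSpace (fun _ _ _ μ => BMOCaseA μ) ∧
    (∀ p₀ : ℝ, 1 < p₀ → ExistsMetricMeasureSpace (fun _ _ _ μ => BMOCaseB μ p₀)) ∧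
    (∀ p₀ : ℝ, 1 ≤ p₀ → ExistsMetricMeasureSpace (fun _ _ _ μ => BMOCaseC μ p₀)) := by
  refine ⟨fun X _ _ _ μ hμ => ⟨BMO_trichotomy hμ, not_caseA_and_caseB μ, not_caseA_and_caseC μ,
    not_caseB_and_caseC μ⟩, ?_, fun p₀ hp₀ => ?_, fun p₀ hp₀ => ?_⟩
  · exact PathSpace.existsMetricMeasureSpace PathSpace.isPathWeight_geometric
      (PathSpace.isPathWeight_geometric.caseA fun p _ =>
        PathSpace.summable_add_two_rpow_mul_geometric p)
  · exact PathSpace.existsMetricMeasureSpace (PathSpace.isPathWeight_rpow hp₀)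
      ((PathSpace.isPathWeight_rpow hp₀).caseB fun p _ => PathSpace.summable_rpow_iff)
  · exact PathSpace.existsMetricMeasureSpace (PathSpace.isPathWeight_log hp₀)
      ((PathSpace.isPathWeight_log hp₀).caseC fun p _ => PathSpace.summable_log_iff)
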